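/- For $n\in\mathbb N=\{0,1,2,\dots\}$ let $q_n(u)=\sum_{k=0}^n \frac{\binom nk}{\binom{2n}{k}}\frac{2^k}{k!}u^k$ be the (normalized) Bessel polynomial; since $\deg q_n=n$, the $q_k$ form a basis of $\mathbb R[u]$. For $n,m\in\mathbb N$ and $0\le a\le 1$ let $\beta^{(n,m)}_k(a)$ $(k\in\mathbb N)$ be the coefficient of $q_k(u)$ in the expansion of $q_n(au)\,q_m((1-a)u)$ in this basis. For $\nu>0$ let $\tilde\gamma_\nu$ be the inverse Gamma distribution with scale $\tfrac14$ and shape $\nu$, i.e. the measure on $\mathbb R$ with density $$h_\nu(t)=\frac{1}{2^{2\nu}\Gamma(\nu)}\,e^{-1/(4t)}\,t^{-\nu-1}\quad(t>0),\qquad h_\nu(t)=0\quad(t\le 0),$$ let $\sigma_\nu$ be the Student-t distribution with density $f_\nu(x)=\frac{\Gamma(\nu+\frac12)}{\Gamma(\frac12)\Gamma(\nu)}(1+x^2)^{-\nu-\frac12}$ on $\mathbb R$, and let $g_t(x)=(4\pi t)^{-1/2}e^{-x^2/(4t)}$ for $t>0$. For $b\in\mathbb R$ let $\tau_b(\mu)$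 be the image of a measure $\mu$ on $\mathbb R$ under $x\mapsto bx$, and write $n\wedge m=\min(n,m)$. Let $n,m\in\mathbb N$ and $0\le a\le1$. Then: (i) $q_n(au)\,q_m((1-a)u)=\sum_{k=n\wedge m}^{n+m}\beta_k^{(n,m)}(a)\,q_k(u)$ for all $u\in\mathbb R$, with $\beta_k^{(n,m)}(a)\ge 0$ for all $k$ and $\sum_{k=n\wedge m}^{n+m}\beta_k^{(n,m)}(a)=1$. (ii) If $Z_n,Z_m$ are independent real random variables (on any probability space, also when $n=m$) with distributions $\tilde\gamma_{n+1/2}$ and $\tilde\gamma_{m+1/2}$ respectively, then $a^2Z_n+(1-a)^2Z_m$ has the density $\sum_{k=n\wedge m}^{n+m}\beta_k^{(n,m)}(a)\,h_{k+1/2}$, which by (i) is a convex combination of inverse Gamma densities. (iii) For every $\nu>0$, $\tilde\gamma_\nu$ and $\sigma_\nu$ are probability measures, and $f_\nu(x)=\int g_t(x)\,d\tilde\gamma_\nu(t)$ for all $x\in\mathbb R$. (iv) For every family of real numbers $(c_k)_{n\wedge m\le k\le n+m}$ the following are equivalent: (a) $c_k=\beta_k^{(n,m)}(a)$ for all $n\wedge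 m\le k\le n+m$; (b) $q_n(au)\,q_m((1-a)u)=\sum_{k=n\wedge m}^{n+m}c_k\,q_k(u)$ for all $u\in\mathbb R$; (c) $\tau_a(\sigma_{n+1/2})*\tau_{1-a}(\sigma_{m+1/2})=\sum_{k=n\wedge m}^{n+m}c_k\,\sigma_{k+1/2}$; (d) $\tau_{a^2}(\tilde\gamma_{n+1/2})*\tau_{(1-a)^2}(\tilde\gamma_{m+1/2})=\sum_{k=n\wedge m}^{n+m}c_k\,\tilde\gamma_{k+1/2}$, where (c) and (d) are equalities of finite signed measures on $\mathbb R$. -/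

import Mathlib

open MeasureTheory ProbabilityTheory

/-- The coefficient `α_k^{(n)} = (n choose k) / (2n choose k) * 2^k / k!`. -/
noncomputable def besselCoeff (n k : ℕ) : ℝ :=
  (n.choose k : ℝ) / ((2 * n).choose k : ℝ) * (2 ^ k / (k.factorial : ℝ))

/-- The normalized Bessel polynomial `q_n(u) = ∑_{k=0}^n α_k^{(n)} u^k`. -/
noncomputable def besselQ (n : ℕ) : Polynomial ℝ :=
  ∑ k ∈ Finset.range (n + 1), Polynomial.C (besselCoeff n k) * Polynomial.X ^ k

theorem besselCoeff_self_ne_zero (n : ℕ) : besselCoeff n n ≠ 0 := by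
  have h : 0 < (2 * n).choose n := Nat.choose_pos (by omega)
  have h' : (((2 * n).choose n : ℕ) : ℝ) ≠ 0 := by exact_mod_cast h.ne'
  unfold besselCoeff
  rw [Nat.choose_self]
  positivity

theorem besselQ_degree (n : ℕ) : (besselQ n).degree = n := by
  have hlt : (∑ k ∈ Finset.range n,
      Polynomial.C (besselCoeff n k) * Polynomial.X ^ k).degree < (n : WithBot ℕ) := by
    rw [← Polynomial.mem_degreeLT]
    refine Submodule.sum_mem _ fun k hk => ?_
    rw [Polynomial.mem_degreeLT]
    refine (Polynomial.degree_C_mul_X_pow_le k _).trans_lt ?_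
    exact_mod_cast Finset.mem_range.mp hk
  have htop := Polynomial.degree_C_mul_X_pow n (besselCoeff_self_ne_zero n)
  rw [besselQ, Finset.sum_range_succ,
    Polynomial.degree_add_eq_right_of_degree_lt (by rw [htop]; exact hlt), htop]

/-- The Bessel polynomials `q_0, q_1, …`, with `q_n` of degree `n`. -/
noncomputable def besselSequence : Polynomial.Sequence ℝ where
  elems' := besselQ
  degree_eq' := besselQ_degree

/-- The Bessel polynomials as a basis of the real vector space `ℝ[X]`. -/
noncomputable def besselBasis : Module.Basis ℕ ℝ (Polynomial ℝ) :=
  besselSequence.basis fun i =>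
    isUnit_iff_ne_zero.mpr (Polynomial.leadingCoeff_ne_zero.mpr (besselSequence.ne_zero i))

/-- The linearization coefficient `β_k^{(n,m)}(a)`: the coefficient of `q_k(u)` when the polynomial
`q_n(a u) q_m((1 - a) u)` in `u` is expanded in the basis of Bessel polynomials. -/
noncomputable def besselBeta (n m : ℕ) (a : ℝ) (k : ℕ) : ℝ :=
  besselBasis.repr
    ((besselQ n).comp (Polynomial.C a * Polynomial.X) *
      (besselQ m).comp (Polynomial.C (1 - a) * Polynomial.X)) k

/-- The inverse Gamma density on the half-line with scale parameter `1/4` and shape parameter `ν`: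
`t ↦ exp (-1/(4t)) t^(-ν-1) / (2^(2ν) Γ(ν))` for `t > 0`. -/
noncomputable def invGammaPDFReal (ν t : ℝ) : ℝ :=
  if 0 < t then
    1 / ((2 : ℝ) ^ (2 * ν) * Real.Gamma ν) * Real.exp (-(1 / (4 * t))) * t ^ (-ν - 1)
  else 0

/-- The inverse Gamma distribution with scale parameter `1/4` and shape parameter `ν`. -/
noncomputable def invGammaMeasure (ν : ℝ) : Measure ℝ :=
  volume.withDensity fun t => ENNReal.ofReal (invGammaPDFReal ν t)

/-- The Student-t density
`f_ν(x) = Γ(ν + 1/2) / (Γ(1/2) Γ(ν)) * (1 + x²)^(-(ν + 1/2))` with `2ν` degrees of freedom,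
without the usual scaling. -/
noncomputable def studentPDFReal (ν x : ℝ) : ℝ :=
  Real.Gamma (ν + 1 / 2) / (Real.Gamma (1 / 2) * Real.Gamma ν) / (1 + x ^ 2) ^ (ν + 1 / 2)

/-- The Student-t distribution `σ_ν` with density `f_ν`. -/
noncomputable def studentMeasure (ν : ℝ) : Measure ℝ :=
  volume.withDensity fun x => ENNReal.ofReal (studentPDFReal ν x)

/-- The Gaussian semigroup `g_t(x) = (4πt)^(-1/2) exp (-x²/(4t))`, `t > 0`. -/
noncomputable def gaussSemigroup (t x : ℝ) : ℝ :=
  1 / Real.sqrt (4 * Real.pi * t) * Real.exp (-(x ^ 2 / (4 * t)))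

/-!
Everything follows from the behaviour of `k_n(u) = exp (-u) q_n(u)`, for which
`k_n' = -u / (2 n - 1) k_{n-1}` when `n ≥ 1`.

*Linearization.* Differentiating `k_n(a u) k_m((1 - a) u) = ∑ β_k k_k(u)` gives, for `n, m ≥ 1`,
`β_0 = 0` and
`β_{k+1}^{(n,m)} / (2 k + 1) = a² / (2 n - 1) β_k^{(n-1,m)} + (1 - a)² / (2 m - 1) β_k^{(n,m-1)}`.
This recursion preserves nonnegativity and shifts the lower end of the support, so it suffices to
treat a single dilate `q_n(a u)`. There, `∑ₙ (2n choose n) q_n(u) Xⁿ = exp (2 u Z) / (1 - 2 Z)` with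
`Z = X + Z²`; substituting `W = a Z (1 - a Z)` for `X` replaces `Z` by `a Z`, so the coefficients of
`q_n(a u)` are, up to positive factors, those of `(1 - 2 a Z) / (1 - 2 Z) * W ^ k`. Both
`W = a X + a (1 - a) Z²` and `(1 - 2 a Z) / (1 - 2 Z) = 1 + 2 (1 - a) Z / (1 - 2 Z)` have nonnegative
coefficients (`isNonnegBesselComb_besselProd_zero`).

*Distributions.* The Laplace transform of the inverse Gamma distribution with shape `n + 1/2` at
`u²` is `k_n(u)`: it satisfies the same differential recursion, and for `n = 0` the substitution
`t ↦ 1 / (4 x t)` yields a first order equation (`mgf_invGammaMeasure_half`). By subordination, the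
characteristic function of the Student-t distribution at `y` is `k_n(|y|)`. Thus the expansion of
the product of Bessel polynomials is the expansion of either convolution, because characteristic
functions determine finite measures and so do Laplace transforms (`ext_of_mgf_eq_of_nonpos`).
The coefficients are unique because a linear relation between the measures becomes one between the
`k_k` after integration, and the Bessel polynomials are linearly independent.
-/

/-! ### Coefficients and derivatives of Bessel polynomials -/

theorem besselCoeff_add_self (k d : ℕ) : besselCoeff (k + d) k =
    ((k + d).factorial * (k + 2 * d).factorial * 2 ^ k : ℝ) /
      (d.factorial * (2 * k + 2 * d).factorial * k.factorial) := by
  have h1 : ((k + d).choose k : ℝ) * k.factorial * d.factorial = (k + d).factorial := by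
    have := Nat.add_choose_mul_factorial_mul_factorial d k
    rw [add_comm d k, mul_right_comm] at this
    exact_mod_cast this
  have h2 : ((2 * (k + d)).choose k : ℝ) * k.factorial * (k + 2 * d).factorial =
      (2 * k + 2 * d).factorial := by
    have := Nat.add_choose_mul_factorial_mul_factorial (k + 2 * d) k
    rw [show k + 2 * d + k = 2 * (k + d) by ring, mul_right_comm] at this
    rw [show 2 * k + 2 * d = 2 * (k + d) by ring]
    exact_mod_cast this
  have h3 : ((2 * (k + d)).choose k : ℝ) ≠ 0 := by
    have : 0 < (2 * (k + d)).choose k := Nat.choose_pos (by omega)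
    exact_mod_cast this.ne'
  have := Nat.factorial_pos d
  have := Nat.factorial_pos k
  have := Nat.factorial_pos (k + 2 * d)
  rw [besselCoeff, ← h1, ← h2]
  field_simp

theorem besselCoeff_eq_zero_of_lt {n k : ℕ} (h : n < k) : besselCoeff n k = 0 := by
  simp [besselCoeff, Nat.choose_eq_zero_of_lt h]

@[simp]
theorem besselCoeff_zero_right (n : ℕ) : besselCoeff n 0 = 1 := by
  simp [besselCoeff]

theorem coeff_besselQ (n k : ℕ) : (besselQ n).coeff k = besselCoeff n k := by
  rw [besselQ, Polynomial.finsetSum_coeff]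
  simp only [Polynomial.coeff_C_mul_X_pow]
  rw [Finset.sum_ite_eq]
  split_ifs with h
  · rfl
  · rw [besselCoeff_eq_zero_of_lt (by simpa using h)]

@[simp]
theorem besselQ_eval_zero (n : ℕ) : (besselQ n).eval 0 = 1 := by
  rw [← Polynomial.coeff_zero_eq_eval_zero, coeff_besselQ, besselCoeff_zero_right]

theorem besselQ_zero : besselQ 0 = 1 := by
  simp [besselQ]

theorem besselCoeff_succ_one (n : ℕ) : besselCoeff (n + 1) 1 = 1 := by
  have h : (2 * (n + 1 : ℝ)) ≠ 0 := by positivity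
  simp only [besselCoeff, Nat.choose_one_right]
  push_cast
  field_simp
  simp

theorem besselCoeff_recurrence (n j : ℕ) :
    (j + 2) * besselCoeff (n + 1) (j + 2) =
      besselCoeff (n + 1) (j + 1) - besselCoeff n j / (2 * n + 1) := by
  rcases lt_trichotomy n j with h | rfl | h
  · rw [besselCoeff_eq_zero_of_lt (by omega), besselCoeff_eq_zero_of_lt (by omega),
      besselCoeff_eq_zero_of_lt h]
    simp
  · rw [besselCoeff_eq_zero_of_lt (by omega)]
    have h1 := besselCoeff_add_self (n + 1) 0
    have h2 := besselCoeff_add_self n 0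
    simp only [add_zero, mul_zero, Nat.factorial_zero, Nat.cast_one, one_mul] at h1 h2
    rw [h1, h2, show 2 * (n + 1) = 2 * n + 1 + 1 by ring]
    simp only [Nat.factorial_succ]
    have := Nat.factorial_pos n
    have := Nat.factorial_pos (2 * n)
    push_cast
    field_simp
    ring
  · obtain ⟨d, rfl⟩ : ∃ d, n = j + 1 + d := ⟨n - (j + 1), by omega⟩
    have h1 := besselCoeff_add_self (j + 2) d
    have h2 := besselCoeff_add_self (j + 1) (d + 1)
    have h3 := besselCoeff_add_self j (d + 1)
    rw [show j + 1 + d + 1 = j + 2 + d by ring, h1, show j + 2 + d = j + 1 + (d + 1) by ring, h2,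
      show j + 1 + d = j + (d + 1) by ring, h3]
    rw [show j + 1 + (d + 1) = j + d + 1 + 1 by ring,
      show j + 2 + 2 * d = j + 2 * d + 1 + 1 by ring,
      show 2 * (j + 2) + 2 * d = 2 * j + 2 * d + 1 + 1 + 1 + 1 by ring,
      show j + 1 + 2 * (d + 1) = j + 2 * d + 1 + 1 + 1 by ring,
      show 2 * (j + 1) + 2 * (d + 1) = 2 * j + 2 * d + 1 + 1 + 1 + 1 by ring,
      show j + (d + 1) = j + d + 1 by ring, show j + 2 * (d + 1) = j + 2 * d + 1 + 1 by ring,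
      show 2 * j + 2 * (d + 1) = 2 * j + 2 * d + 1 + 1 by ring]
    simp only [Nat.factorial_succ]
    have := Nat.factorial_pos d
    have := Nat.factorial_pos j
    have := Nat.factorial_pos (j + d)
    have := Nat.factorial_pos (j + 2 * d)
    have := Nat.factorial_pos (2 * j + 2 * d)
    push_cast
    field_simp
    ring

open Polynomial in
theorem derivative_besselQ_succ (n : ℕ) : derivative (besselQ (n + 1)) =
    besselQ (n + 1) - C (1 / (2 * n + 1 : ℝ)) * (X * besselQ n) := by
  ext k
  rw [coeff_derivative, coeff_sub, coeff_C_mul, coeff_besselQ, coeff_besselQ]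
  cases k with
  | zero => simp [besselCoeff_succ_one]
  | succ j =>
    rw [coeff_X_mul, coeff_besselQ]
    have := besselCoeff_recurrence n j
    push_cast
    linear_combination this

/-! ### The recursion for products of dilates -/

/-- The polynomial `q_n(a u) q_m((1 - a) u)` in `u`. -/
noncomputable def besselProd (n m : ℕ) (a : ℝ) : Polynomial ℝ :=
  (besselQ n).comp (Polynomial.C a * Polynomial.X) *
    (besselQ m).comp (Polynomial.C (1 - a) * Polynomial.X)

theorem besselProd_eval (n m : ℕ) (a u : ℝ) : (besselProd n m a).eval u =
    (besselQ n).eval (a * u) * (besselQ m).eval ((1 - a) * u) := by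
  simp [besselProd]

theorem besselProd_comm (n m : ℕ) (a : ℝ) : besselProd n m a = besselProd m n (1 - a) := by
  simp only [besselProd, sub_sub_cancel]
  rw [mul_comm]

open Polynomial in
theorem derivative_besselProd (n m : ℕ) (a : ℝ) :
    derivative (besselProd (n + 1) (m + 1) a) = besselProd (n + 1) (m + 1) a -
      X * (C (a ^ 2 / (2 * n + 1)) * besselProd n (m + 1) a +
        C ((1 - a) ^ 2 / (2 * m + 1)) * besselProd (n + 1) m a) := by
  have h : ∀ (k : ℕ) (b : ℝ), derivative ((besselQ (k + 1)).comp (C b * X)) =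
      C b * (besselQ (k + 1)).comp (C b * X) -
        C (b ^ 2 / (2 * k + 1)) * (X * (besselQ k).comp (C b * X)) := by
    intro k b
    rw [derivative_comp, derivative_besselQ_succ]
    simp only [derivative_C_mul, derivative_X, mul_one, sub_comp, mul_comp, C_comp, X_comp]
    rw [show b ^ 2 / (2 * (k : ℝ) + 1) = b * b * (1 / (2 * k + 1)) by ring, C_mul, C_mul]
    ring
  have hc : (C a + C (1 - a) : ℝ[X]) = 1 := by rw [← C_add]; simp
  simp only [besselProd, derivative_mul, h]
  linear_combination ((besselQ (n + 1)).comp (C a * X) * (besselQ (m + 1)).comp (C (1 - a) * X)) * hc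

/-- A real polynomial equal to its derivative vanishes. -/
theorem eq_zero_of_derivative_eq_self {p : Polynomial ℝ} (h : Polynomial.derivative p = p) :
    p = 0 := by
  by_contra hp
  exact (Polynomial.degree_derivative_lt hp).ne (by rw [h])

/-- `p` is a combination with nonnegative coefficients of the Bessel polynomials `q_k` with
`l ≤ k ≤ N`. The sum runs over all `k ≤ N`; the lower bound is a condition on the coefficients. -/
def IsNonnegBesselComb (l N : ℕ) (p : Polynomial ℝ) : Prop :=
  ∃ c : ℕ → ℝ, (∀ k, 0 ≤ c k) ∧ (∀ k, k < l → c k = 0) ∧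
    p = ∑ k ∈ Finset.range (N + 1), Polynomial.C (c k) * besselQ k

open Polynomial in
/-- For positive degrees the product of dilates inherits nonnegative coefficients from the products
with one degree lowered. The candidate coefficients are
`b (k + 1) = (2 k + 1) (a² / (2 n + 1) c k + (1 - a)² / (2 m + 1) d k)` and `b 0 = 0`; the difference
of the two sides is then equal to its own derivative. -/
theorem isNonnegBesselComb_besselProd_succ {n m : ℕ} {a : ℝ}
    (h1 : IsNonnegBesselComb (min n (m + 1)) (n + m + 1) (besselProd n (m + 1) a))
    (h2 : IsNonnegBesselComb (min (n + 1) m) (n + m + 1) (besselProd (n + 1) m a)) :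
    IsNonnegBesselComb (min (n + 1) (m + 1)) (n + m + 2) (besselProd (n + 1) (m + 1) a) := by
  obtain ⟨c, hc0, hcl, hc⟩ := h1
  obtain ⟨d, hd0, hdl, hd⟩ := h2
  let e : ℕ → ℝ := fun k => a ^ 2 / (2 * n + 1) * c k + (1 - a) ^ 2 / (2 * m + 1) * d k
  let b : ℕ → ℝ := fun k => Nat.casesOn k 0 fun j => (2 * j + 1) * e j
  have he : ∀ k, 0 ≤ e k := fun k =>
    add_nonneg (mul_nonneg (by positivity) (hc0 k)) (mul_nonneg (by positivity) (hd0 k))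
  refine ⟨b, fun k => ?_, fun k hk => ?_, ?_⟩
  · cases k with
    | zero => exact le_rfl
    | succ j => exact mul_nonneg (by positivity) (he j)
  · cases k with
    | zero => rfl
    | succ j =>
      change (2 * (j : ℝ) + 1) * (_ * c j + _ * d j) = 0
      rw [hcl j (by omega), hdl j (by omega)]
      simp
  · rw [← sub_eq_zero]
    apply eq_zero_of_derivative_eq_self
    rw [derivative_sub, derivative_besselProd, Finset.sum_range_succ']
    rw [show b 0 = 0 from rfl, C_0, zero_mul, add_zero, derivative_sum]
    have hb : ∀ k ∈ Finset.range (n + m + 2), derivative (C (b (k + 1)) * besselQ (k + 1)) =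
        C (b (k + 1)) * besselQ (k + 1) - X * (C (a ^ 2 / (2 * n + 1)) * (C (c k) * besselQ k) +
          C ((1 - a) ^ 2 / (2 * m + 1)) * (C (d k) * besselQ k)) := by
      intro k _
      have hk : (2 * (k : ℝ) + 1) ≠ 0 := by positivity
      have : C (b (k + 1)) * C (1 / (2 * (k : ℝ) + 1)) =
          C (a ^ 2 / (2 * n + 1)) * C (c k) + C ((1 - a) ^ 2 / (2 * m + 1)) * C (d k) := by
        rw [← C_mul, ← C_mul, ← C_mul, ← C_add]
        congr 1
        change (2 * (k : ℝ) + 1) * e k * (1 / (2 * (k : ℝ) + 1)) = e k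
        field_simp
      rw [derivative_C_mul, derivative_besselQ_succ]
      linear_combination (-X * besselQ k) * this
    rw [Finset.sum_congr rfl hb, Finset.sum_sub_distrib, ← Finset.mul_sum,
      Finset.sum_add_distrib, ← Finset.mul_sum, ← Finset.mul_sum, hc, hd]
    ring

/-! ### Generating functions and a single dilate -/

section PowerSeries
open PowerSeries

/-- The power series `Z` in `X` with `Z = X + Z ^ 2` and no constant term, that is
`Z = (1 - √(1 - 4 X)) / 2`. -/
noncomputable def catalanZ : ℝ⟦X⟧ := X * map (Nat.castRingHom ℝ) catalanSeries

/-- The generating function `1 / √(1 - 4 X)` of the central binomial coefficients. -/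
noncomputable def centralBinomSeries : ℝ⟦X⟧ := mk fun n => (n.centralBinom : ℝ)

theorem catalanZ_eq : catalanZ = X + catalanZ ^ 2 := by
  have h := congrArg (map (Nat.castRingHom ℝ)) catalanSeries_sq_mul_X_add_one
  rw [map_add, map_mul, map_pow, map_X, map_one] at h
  rw [catalanZ]
  linear_combination (-(X : ℝ⟦X⟧)) * h

theorem derivative_catalanZ : PowerSeries.derivative ℝ catalanZ = centralBinomSeries := by
  ext n
  rw [coeff_derivative, catalanZ, coeff_succ_X_mul, coeff_map, catalanSeries_coeff,
    centralBinomSeries, coeff_mk, ← succ_mul_catalan_eq_centralBinom]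
  push_cast
  simp [mul_comm]

/-- Differentiating `Z = X + Z ^ 2` gives `Z' (1 - 2 Z) = 1`. -/
theorem centralBinomSeries_mul : centralBinomSeries * (1 - 2 * catalanZ) = 1 := by
  have h := congrArg (PowerSeries.derivative ℝ) catalanZ_eq
  rw [map_add, derivative_X, derivative_pow, derivative_catalanZ] at h
  simp only [Nat.cast_ofNat, Nat.add_one_sub_one, pow_one] at h
  linear_combination h

@[simp]
theorem constantCoeff_catalanZ : constantCoeff catalanZ = 0 := by
  simp [catalanZ]

/-- The coefficient of `X ^ (j + d)` in `Z ^ j / (1 - 2 Z)` is `(j + 2 d choose d)`; the induction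
over two steps is Pascal's rule, because `Z ^ 2 = Z - X`. -/
theorem catalanZ_pow_mul_centralBinomSeries (j : ℕ) : catalanZ ^ j * centralBinomSeries =
    X ^ j * mk fun d => ((j + 2 * d).choose d : ℝ) := by
  induction j using Nat.twoStepInduction with
  | zero => simp [centralBinomSeries, Nat.centralBinom]
  | one =>
    have h : (2 : ℝ⟦X⟧) * (X * mk fun d => ((1 + 2 * d).choose d : ℝ)) =
        centralBinomSeries - 1 := by
      ext n
      rw [← map_ofNat (C (R := ℝ)) 2, coeff_C_mul]
      cases n with
      | zero => simp [centralBinomSeries]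
      | succ d =>
        rw [coeff_succ_X_mul, coeff_mk, map_sub, centralBinomSeries, coeff_mk, coeff_one,
          Nat.centralBinom, if_neg (by omega), show 2 * (d + 1) = (2 * d + 1) + 1 by ring,
          Nat.choose_succ_succ', Nat.choose_symm_half d, add_comm 1]
        push_cast
        ring
    have h2 : (2 : ℝ⟦X⟧) ≠ 0 := fun h0 => by
      have := congrArg constantCoeff h0
      rw [map_ofNat] at this
      norm_num at this
    apply mul_left_cancel₀ h2
    rw [pow_one, pow_one, h]
    linear_combination -centralBinomSeries_mul
  | more j h0 h1 =>
    have h : (X : ℝ⟦X⟧) * (mk fun d => ((j + 2 + 2 * d).choose d : ℝ)) =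
        (mk fun d => ((j + 1 + 2 * d).choose d : ℝ)) - mk fun d => ((j + 2 * d).choose d : ℝ) := by
      ext n
      cases n with
      | zero => simp
      | succ d =>
        rw [coeff_succ_X_mul, map_sub, coeff_mk, coeff_mk, coeff_mk,
          show j + 1 + 2 * (d + 1) = (j + 2 + 2 * d) + 1 by ring, Nat.choose_succ_succ,
          show j + 2 * (d + 1) = j + 2 + 2 * d by ring]
        push_cast
        ring
    linear_combination (-catalanZ ^ j * centralBinomSeries) * catalanZ_eq + h1 - X * h0 -
      X ^ (j + 1) * h

/-- The generating function of the normalized Bessel polynomials, read off at `u ^ j`: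
`∑ₙ (2n choose n) qₙ(u) Xⁿ = exp (2 u Z) / √(1 - 4 X)`. -/
theorem centralBinom_mul_besselCoeff (n j : ℕ) : n.centralBinom * besselCoeff n j =
    2 ^ j / j.factorial * coeff n (catalanZ ^ j * centralBinomSeries) := by
  rw [catalanZ_pow_mul_centralBinomSeries, coeff_X_pow_mul']
  split_ifs with h
  · obtain ⟨d, rfl⟩ := Nat.exists_eq_add_of_le h
    rw [coeff_mk, Nat.add_sub_cancel_left, besselCoeff_add_self]
    have h1 : ((j + 2 * d).choose d : ℝ) * (j + d).factorial * d.factorial =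
        (j + 2 * d).factorial := by
      have := Nat.add_choose_mul_factorial_mul_factorial (j + d) d
      rw [show j + d + d = j + 2 * d by ring] at this
      exact_mod_cast this
    have h2 : ((j + d).centralBinom : ℝ) * (j + d).factorial * (j + d).factorial =
        (2 * j + 2 * d).factorial := by
      have := Nat.add_choose_mul_factorial_mul_factorial (j + d) (j + d)
      rw [← two_mul] at this
      rw [show 2 * j + 2 * d = 2 * (j + d) by ring, Nat.centralBinom]
      exact_mod_cast this
    have : ((j + d).centralBinom : ℝ) ≠ 0 := by exact_mod_cast Nat.centralBinom_ne_zero _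
    have := Nat.factorial_pos d
    have := Nat.factorial_pos j
    have := Nat.factorial_pos (j + d)
    rw [← h1, ← h2]
    field_simp
  · rw [besselCoeff_eq_zero_of_lt (by omega)]
    simp

/-- The series `a X + a (1 - a) Z ^ 2 = (a Z) (1 - a Z)`; substituting it for `X` in `Z` gives
`a Z`. -/
noncomputable def dilationSubst (a : ℝ) : ℝ⟦X⟧ := C a * X + C (a * (1 - a)) * catalanZ ^ 2

theorem dilationSubst_eq (a : ℝ) :
    dilationSubst a = C a * catalanZ * (1 - C a * catalanZ) := by
  rw [dilationSubst, map_mul, map_sub, map_one]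
  linear_combination (-C a) * catalanZ_eq

theorem constantCoeff_dilationSubst (a : ℝ) : constantCoeff (dilationSubst a) = 0 := by
  simp [dilationSubst]

theorem hasSubst_dilationSubst (a : ℝ) : HasSubst (dilationSubst a) :=
  HasSubst.of_constantCoeff_zero' (constantCoeff_dilationSubst a)

/-- Both series solve `Y = W + Y ^ 2` with `W = a Z (1 - a Z)` and have no constant term. -/
theorem subst_dilationSubst_catalanZ (a : ℝ) :
    catalanZ.subst (dilationSubst a) = C a * catalanZ := by
  have hs := hasSubst_dilationSubst a
  set Y : ℝ⟦X⟧ := catalanZ.subst (dilationSubst a) with hY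
  have h1 : Y = dilationSubst a + Y ^ 2 := by
    have := congrArg (subst (dilationSubst a)) catalanZ_eq
    rwa [subst_add hs, subst_pow hs, subst_X hs] at this
  have h0 : constantCoeff Y = 0 :=
    constantCoeff_subst_eq_zero (constantCoeff_dilationSubst a) _ constantCoeff_catalanZ
  have h2 : (Y - C a * catalanZ) * (1 - Y - C a * catalanZ) = 0 := by
    rw [dilationSubst_eq] at h1
    linear_combination h1
  rcases mul_eq_zero.mp h2 with h | h
  · exact sub_eq_zero.mp h
  · have := congrArg constantCoeff h
    simp [h0] at this

theorem subst_dilationSubst_centralBinomSeries (a : ℝ) :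
    centralBinomSeries.subst (dilationSubst a) * (1 - 2 * (C a * catalanZ)) = 1 := by
  have hs := hasSubst_dilationSubst a
  have := congrArg (substAlgHom hs) centralBinomSeries_mul
  rwa [map_mul, map_sub, map_mul, map_one, map_ofNat, coe_substAlgHom,
    subst_dilationSubst_catalanZ] at this

/-- The ratio `(1 - 2 a Z) / (1 - 2 Z)`, written with nonnegative coefficients. -/
noncomputable def dilationFactor (a : ℝ) : ℝ⟦X⟧ :=
  1 + C (2 * (1 - a)) * catalanZ * centralBinomSeries

theorem dilationFactor_eq (a : ℝ) :
    dilationFactor a = centralBinomSeries * (1 - 2 * (C a * catalanZ)) := by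
  rw [dilationFactor, map_mul, map_sub, map_one, map_ofNat]
  linear_combination -centralBinomSeries_mul

/-- Since `W` has no constant term, only finitely many terms of `f` contribute to a coefficient of
`f(W)`. -/
theorem coeff_mul_subst_eq_sum {f T W : ℝ⟦X⟧} (hW : constantCoeff W = 0) (n : ℕ) :
    coeff n (T * f.subst W) =
      ∑ k ∈ Finset.range (n + 1), coeff k f * coeff n (T * W ^ k) := by
  have hs : HasSubst W := HasSubst.of_constantCoeff_zero' hW
  obtain ⟨V, rfl⟩ := X_dvd_iff.mpr hW
  conv_lhs => rw [eq_X_pow_mul_shift_add_trunc (n + 1) f]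
  rw [subst_add hs, subst_mul hs, subst_pow hs, subst_X hs, mul_add, map_add]
  have h0 : ∀ g : ℝ⟦X⟧, coeff n (T * ((X * V) ^ (n + 1) * g)) = 0 := fun g => by
    rw [mul_pow, show T * (X ^ (n + 1) * V ^ (n + 1) * g) = X ^ (n + 1) * (T * V ^ (n + 1) * g) by
      ring, coeff_X_pow_mul', if_neg (by omega)]
  rw [h0, zero_add, subst_coe hs, Polynomial.aeval_eq_sum_range' (natDegree_trunc_lt f n),
    Finset.mul_sum, map_sum]
  refine Finset.sum_congr rfl fun k hk => ?_
  rw [coeff_trunc, if_pos (Finset.mem_range.mp hk), mul_smul_comm, coeff_smul]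
  rfl

/-- A power series with nonnegative coefficients. -/
def HasNonnegCoeffs (f : ℝ⟦X⟧) : Prop := ∀ n, 0 ≤ coeff n f

theorem HasNonnegCoeffs.add {f g : ℝ⟦X⟧} (hf : HasNonnegCoeffs f) (hg : HasNonnegCoeffs g) :
    HasNonnegCoeffs (f + g) := fun n => by
  rw [map_add]; exact add_nonneg (hf n) (hg n)

theorem HasNonnegCoeffs.mul {f g : ℝ⟦X⟧} (hf : HasNonnegCoeffs f) (hg : HasNonnegCoeffs g) :
    HasNonnegCoeffs (f * g) := fun n => by
  rw [coeff_mul]; exact Finset.sum_nonneg fun p _ => mul_nonneg (hf _) (hg _)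

theorem hasNonnegCoeffs_C {r : ℝ} (hr : 0 ≤ r) : HasNonnegCoeffs (C r) := fun n => by
  rw [coeff_C]; split_ifs <;> simp [hr]

theorem hasNonnegCoeffs_X : HasNonnegCoeffs X := fun n => by
  rw [coeff_X]; split_ifs <;> simp

theorem hasNonnegCoeffs_one : HasNonnegCoeffs 1 := by
  simpa using hasNonnegCoeffs_C zero_le_one

theorem HasNonnegCoeffs.pow {f : ℝ⟦X⟧} (hf : HasNonnegCoeffs f) (k : ℕ) :
    HasNonnegCoeffs (f ^ k) := by
  induction k with
  | zero => simpa using hasNonnegCoeffs_one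
  | succ k ih => rw [pow_succ]; exact ih.mul hf

theorem hasNonnegCoeffs_catalanZ : HasNonnegCoeffs catalanZ :=
  hasNonnegCoeffs_X.mul fun n => by simp

theorem hasNonnegCoeffs_centralBinomSeries : HasNonnegCoeffs centralBinomSeries := fun n => by
  simp [centralBinomSeries]

end PowerSeries

/-- The dilate `q_n(a u)`, `0 ≤ a ≤ 1`, is a nonnegative combination of the `q_k(u)`: substituting
`a Z (1 - a Z)` for `X` in the generating function turns `exp (2 u Z)` into `exp (2 u a Z)`, and
`a Z (1 - a Z)` has nonnegative coefficients. -/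
theorem isNonnegBesselComb_besselProd_zero (n : ℕ) {a : ℝ} (ha0 : 0 ≤ a) (ha1 : a ≤ 1) :
    IsNonnegBesselComb 0 n (besselProd n 0 a) := by
  have hG : ∀ k, HasNonnegCoeffs (dilationFactor a * dilationSubst a ^ k) := fun k =>
    (hasNonnegCoeffs_one.add (((hasNonnegCoeffs_C (by linarith)).mul
      hasNonnegCoeffs_catalanZ).mul hasNonnegCoeffs_centralBinomSeries)).mul
      (HasNonnegCoeffs.pow (((hasNonnegCoeffs_C ha0).mul hasNonnegCoeffs_X).add
        ((hasNonnegCoeffs_C (mul_nonneg ha0 (by linarith))).mul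
          (hasNonnegCoeffs_catalanZ.pow 2))) k)
  have hB : (n.centralBinom : ℝ) ≠ 0 := by exact_mod_cast Nat.centralBinom_ne_zero n
  refine ⟨fun k => k.centralBinom / n.centralBinom *
    PowerSeries.coeff n (dilationFactor a * dilationSubst a ^ k),
    fun k => mul_nonneg (by positivity) (hG k n), fun k hk => absurd hk (by omega), ?_⟩
  ext j
  have hs := hasSubst_dilationSubst a
  -- `exp (2 u Z) / (1 - 2 Z)` at `u ^ j`: the factor turns `1 / (1 - 2 a Z)` into `1 / (1 - 2 Z)`
  have hcomp : dilationFactor a *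
      (catalanZ ^ j * centralBinomSeries).subst (dilationSubst a) =
      PowerSeries.C (a ^ j) * (catalanZ ^ j * centralBinomSeries) := by
    rw [PowerSeries.subst_mul hs, PowerSeries.subst_pow hs, subst_dilationSubst_catalanZ,
      dilationFactor_eq, map_pow]
    linear_combination (centralBinomSeries * (PowerSeries.C a * catalanZ) ^ j) *
      subst_dilationSubst_centralBinomSeries a
  have hsum := coeff_mul_subst_eq_sum (f := catalanZ ^ j * centralBinomSeries)
    (T := dilationFactor a) (constantCoeff_dilationSubst a) n
  rw [hcomp, PowerSeries.coeff_C_mul] at hsum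
  have hn := centralBinom_mul_besselCoeff n j
  have hl : (besselProd n 0 a).coeff j = besselCoeff n j * a ^ j := by
    rw [besselProd, besselQ_zero, Polynomial.one_comp, mul_one, Polynomial.comp_C_mul_X_coeff,
      coeff_besselQ]
  rw [hl, Polynomial.finsetSum_coeff]
  simp only [Polynomial.coeff_C_mul, coeff_besselQ]
  apply mul_left_cancel₀ hB
  rw [← mul_assoc, hn, mul_assoc, mul_comm _ (a ^ j), hsum, Finset.mul_sum,
    Finset.mul_sum]
  refine Finset.sum_congr rfl fun k _ => ?_
  have hk := centralBinom_mul_besselCoeff k j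
  rw [show ∀ x y : ℝ, n.centralBinom * (k.centralBinom / n.centralBinom * x * y) =
    (k.centralBinom * y) * x by intros; field_simp, hk]
  ring

/-! ### The linearization coefficients -/

theorem isNonnegBesselComb_besselProd (n m : ℕ) {a : ℝ} (ha0 : 0 ≤ a) (ha1 : a ≤ 1) :
    IsNonnegBesselComb (min n m) (n + m) (besselProd n m a) := by
  induction n generalizing m with
  | zero =>
    rw [besselProd_comm, Nat.zero_min, zero_add]
    exact isNonnegBesselComb_besselProd_zero m (by linarith) (by linarith)
  | succ n ihn =>
    induction m with
    | zero => exact isNonnegBesselComb_besselProd_zero (n + 1) ha0 ha1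
    | succ m ihm =>
      have h2 : n + 1 + m = n + m + 1 := by ring
      rw [show n + 1 + (m + 1) = n + m + 2 by ring]
      exact isNonnegBesselComb_besselProd_succ (ihn (m + 1)) (h2 ▸ ihm)

theorem besselBasis_apply (k : ℕ) : besselBasis k = besselQ k := by
  simp [besselBasis, besselSequence]

/-- Combinations of Bessel polynomials determine their coefficients. -/
theorem eqOn_zero_of_sum_besselQ_eq_zero {s : Finset ℕ} {c : ℕ → ℝ}
    (h : ∑ k ∈ s, Polynomial.C (c k) * besselQ k = 0) : ∀ k ∈ s, c k = 0 := by
  refine linearIndependent_iff'.mp besselBasis.linearIndependent s c ?_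
  simpa only [besselBasis_apply, Polynomial.smul_eq_C_mul] using h

theorem besselBeta_spec (n m : ℕ) {a : ℝ} (ha0 : 0 ≤ a) (ha1 : a ≤ 1) :
    (∀ k, 0 ≤ besselBeta n m a k) ∧
    besselProd n m a = ∑ k ∈ Finset.Icc (min n m) (n + m),
      Polynomial.C (besselBeta n m a k) * besselQ k := by
  obtain ⟨c, hc0, hcl, hc⟩ := isNonnegBesselComb_besselProd n m ha0 ha1
  have hβ : ∀ k, besselBeta n m a k = if k ∈ Finset.range (n + m + 1) then c k else 0 := by
    intro k
    change besselBasis.repr (besselProd n m a) k = _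
    simp_rw [hc, ← Polynomial.smul_eq_C_mul, ← besselBasis_apply]
    rw [map_sum, Finsupp.finsetSum_apply]
    simp only [map_smul, Module.Basis.repr_self, Finsupp.smul_apply, Finsupp.single_apply,
      smul_eq_mul, mul_ite, mul_one, mul_zero]
    rw [Finset.sum_ite_eq']
  refine ⟨fun k => ?_, ?_⟩
  · rw [hβ]
    split_ifs
    exacts [hc0 k, le_rfl]
  · rw [hc]
    symm
    apply Finset.sum_subset_zero_on_sdiff
    · intro k hk
      have := (Finset.mem_Icc.mp hk).2
      exact Finset.mem_range.mpr (by omega)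
    · intro k hk
      rw [Finset.mem_sdiff, Finset.mem_range, Finset.mem_Icc] at hk
      rw [hcl k (by omega)]
      simp
    · intro k hk
      have := (Finset.mem_Icc.mp hk).2
      rw [hβ, if_pos (Finset.mem_range.mpr (by omega))]

/-! ### Inverse Gamma and Student-t distributions -/

open Set in
theorem integrableOn_exp_neg_div_mul_rpow {s c : ℝ} (hs : 0 < s) (hc : 0 < c) :
    IntegrableOn (fun t : ℝ => Real.exp (-(c / t)) * t ^ (-s - 1)) (Ioi 0) := by
  have h := (integrableOn_Ioi_comp_rpow_iff (fun y : ℝ => y ^ (s - 1) * Real.exp (-c * y ^ (1 : ℝ)))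
    (p := -1) (by norm_num)).mpr
      (integrableOn_rpow_mul_exp_neg_mul_rpow (by linarith) one_pos hc)
  refine h.congr_fun (fun t ht => ?_) measurableSet_Ioi
  have ht : 0 < t := ht
  simp only [Real.rpow_one, abs_neg, abs_one, one_mul, smul_eq_mul]
  rw [← Real.rpow_mul ht.le, ← mul_assoc, ← Real.rpow_add ht, mul_comm, Real.rpow_neg_one]
  congr 2 <;> ring_nf

open Set in
/-- The substitution `t ↦ 1 / t` reduces this integral to the Gamma integral. -/
theorem integral_exp_neg_div_mul_rpow {s c : ℝ} (hs : 0 < s) (hc : 0 < c) :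
    ∫ t in Ioi (0 : ℝ), Real.exp (-(c / t)) * t ^ (-s - 1) = Real.Gamma s * c ^ (-s) := by
  have h := integral_comp_rpow_Ioi (fun y : ℝ => y ^ (s - 1) * Real.exp (-(c * y)))
    (p := -1) (by norm_num)
  rw [Real.integral_rpow_mul_exp_neg_mul_Ioi hs hc] at h
  rw [Real.rpow_neg hc.le, ← Real.inv_rpow hc.le, mul_comm, ← one_div, ← h]
  refine setIntegral_congr_fun measurableSet_Ioi (fun t ht => ?_)
  have ht : 0 < t := ht
  simp only [abs_neg, abs_one, one_mul, smul_eq_mul]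
  rw [← Real.rpow_mul ht.le, ← mul_assoc, ← Real.rpow_add ht, mul_comm, Real.rpow_neg_one]
  congr 2; ring_nf

theorem measurable_invGammaPDFReal (ν : ℝ) : Measurable (invGammaPDFReal ν) := by
  unfold invGammaPDFReal
  refine Measurable.ite measurableSet_Ioi ?_ measurable_const
  fun_prop

theorem invGammaPDFReal_eq_indicator (ν : ℝ) : invGammaPDFReal ν = (Set.Ioi 0).indicator fun t =>
    1 / ((2 : ℝ) ^ (2 * ν) * Real.Gamma ν) * (Real.exp (-((1 / 4) / t)) * t ^ (-ν - 1)) := by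
  ext t
  rw [invGammaPDFReal, Set.indicator_apply]
  refine if_congr Iff.rfl ?_ rfl
  rw [mul_assoc, div_div]

theorem invGammaPDFReal_nonneg {ν : ℝ} (hν : 0 < ν) (t : ℝ) : 0 ≤ invGammaPDFReal ν t := by
  have := Real.Gamma_pos_of_pos hν
  unfold invGammaPDFReal
  split_ifs <;> positivity

theorem two_rpow_two_mul (ν : ℝ) : (2 : ℝ) ^ (2 * ν) = 4 ^ ν := by
  rw [Real.rpow_mul zero_le_two]
  norm_num

theorem integrable_invGammaPDFReal {ν : ℝ} (hν : 0 < ν) : Integrable (invGammaPDFReal ν) := by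
  rw [invGammaPDFReal_eq_indicator, integrable_indicator_iff measurableSet_Ioi]
  exact (integrableOn_exp_neg_div_mul_rpow hν (by norm_num)).const_mul _

theorem integral_invGammaPDFReal {ν : ℝ} (hν : 0 < ν) : ∫ t, invGammaPDFReal ν t = 1 := by
  rw [invGammaPDFReal_eq_indicator, integral_indicator measurableSet_Ioi, integral_const_mul,
    integral_exp_neg_div_mul_rpow hν (by norm_num), two_rpow_two_mul, one_div 4,
    Real.inv_rpow (by norm_num), Real.rpow_neg (by norm_num), inv_inv]
  have := Real.Gamma_pos_of_pos hν
  field_simp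

theorem isProbabilityMeasure_invGammaMeasure {ν : ℝ} (hν : 0 < ν) :
    IsProbabilityMeasure (invGammaMeasure ν) := by
  constructor
  rw [invGammaMeasure, withDensity_apply _ MeasurableSet.univ, Measure.restrict_univ,
    ← ofReal_integral_eq_lintegral_ofReal (integrable_invGammaPDFReal hν)
      (Filter.Eventually.of_forall (invGammaPDFReal_nonneg hν)), integral_invGammaPDFReal hν,
    ENNReal.ofReal_one]

theorem integral_invGammaMeasure {ν : ℝ} (hν : 0 < ν) (f : ℝ → ℝ) :
    ∫ t, f t ∂(invGammaMeasure ν) = ∫ t in Set.Ioi 0, invGammaPDFReal ν t * f t := by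
  rw [invGammaMeasure, integral_withDensity_eq_integral_toReal_smul
    (measurable_invGammaPDFReal ν).ennreal_ofReal (by simp), ← integral_indicator measurableSet_Ioi]
  congr 1
  ext t
  rw [ENNReal.toReal_ofReal (invGammaPDFReal_nonneg hν t), smul_eq_mul, Set.indicator_apply]
  split_ifs with ht
  · rfl
  · rw [invGammaPDFReal, if_neg (by simpa using ht), zero_mul]

theorem ae_pos_invGammaMeasure (ν : ℝ) : ∀ᵐ t ∂(invGammaMeasure ν), 0 < t := by
  rw [invGammaMeasure, ae_withDensity_iff (measurable_invGammaPDFReal ν).ennreal_ofReal]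
  refine Filter.Eventually.of_forall fun t ht => ?_
  by_contra h
  simp [invGammaPDFReal, h] at ht

/-- The integrand is again of the form `exp (-c / t) t ^ (-s - 1)`, with `c = (1 + x ^ 2) / 4` and
`s = ν + 1 / 2`. -/
theorem studentPDFReal_eq_integral {ν : ℝ} (hν : 0 < ν) (x : ℝ) :
    studentPDFReal ν x = ∫ t, gaussSemigroup t x ∂(invGammaMeasure ν) := by
  have hc : 0 < (1 + x ^ 2) / 4 := by positivity
  have hG := Real.Gamma_pos_of_pos hν
  have hpi := Real.pi_pos
  have hcongr : ∀ t ∈ Set.Ioi (0 : ℝ), invGammaPDFReal ν t * gaussSemigroup t x =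
      1 / (4 ^ ν * Real.Gamma ν * (2 * Real.sqrt Real.pi)) *
        (Real.exp (-(((1 + x ^ 2) / 4) / t)) * t ^ (-(ν + 1 / 2) - 1)) := by
    intro t ht
    have ht : 0 < t := ht
    have h1 : Real.exp (-(((1 + x ^ 2) / 4) / t)) =
        Real.exp (-(1 / (4 * t))) * Real.exp (-(x ^ 2 / (4 * t))) := by
      rw [← Real.exp_add]; congr 1; field_simp; ring
    have h2 : t ^ (-(ν + 1 / 2) - 1) = t ^ (-ν - 1) / Real.sqrt t := by
      rw [Real.sqrt_eq_rpow, ← Real.rpow_sub ht]; congr 1; ring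
    have h3 : Real.sqrt (4 * Real.pi * t) = 2 * Real.sqrt Real.pi * Real.sqrt t := by
      rw [Real.sqrt_mul (by positivity), Real.sqrt_mul (by norm_num),
        show (4 : ℝ) = 2 ^ 2 by norm_num, Real.sqrt_sq (by norm_num)]
    rw [invGammaPDFReal, if_pos ht, gaussSemigroup, h1, h2, h3, two_rpow_two_mul]
    have := Real.sqrt_pos.mpr ht
    have := Real.sqrt_pos.mpr hpi
    field_simp
  rw [integral_invGammaMeasure hν, setIntegral_congr_fun measurableSet_Ioi hcongr,
    integral_const_mul, integral_exp_neg_div_mul_rpow (by positivity) hc, studentPDFReal,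
    Real.Gamma_one_half_eq, Real.rpow_neg hc.le, Real.div_rpow (by positivity) (by norm_num),
    Real.rpow_add (by norm_num : (0 : ℝ) < 4), ← Real.sqrt_eq_rpow 4,
    show (4 : ℝ) = 2 ^ 2 by norm_num, Real.sqrt_sq (by norm_num)]
  have := Real.sqrt_pos.mpr hpi
  have : 0 < (1 + x ^ 2) ^ (ν + 1 / 2) := by positivity
  field_simp

theorem gaussSemigroup_eq_gaussianPDFReal {t : ℝ} (ht : 0 < t) (x : ℝ) :
    gaussSemigroup t x = gaussianPDFReal 0 (2 * t).toNNReal x := by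
  rw [gaussSemigroup, gaussianPDFReal, Real.coe_toNNReal _ (by positivity), one_div, sub_zero,
    neg_div]
  ring_nf

theorem gaussSemigroup_nonneg (t x : ℝ) : 0 ≤ gaussSemigroup t x := by
  unfold gaussSemigroup; positivity

theorem measurable_uncurry_gaussSemigroup :
    Measurable fun p : ℝ × ℝ => gaussSemigroup p.2 p.1 := by
  unfold gaussSemigroup
  fun_prop

theorem integrable_gaussSemigroup_prod {ν : ℝ} (hν : 0 < ν) :
    Integrable (fun p : ℝ × ℝ => gaussSemigroup p.2 p.1) (volume.prod (invGammaMeasure ν)) := by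
  have := isProbabilityMeasure_invGammaMeasure hν
  rw [integrable_prod_iff' measurable_uncurry_gaussSemigroup.aestronglyMeasurable]
  refine ⟨?_, ?_⟩
  · filter_upwards [ae_pos_invGammaMeasure ν] with t ht
    simp_rw [gaussSemigroup_eq_gaussianPDFReal ht]
    exact integrable_gaussianPDFReal _ _
  · refine (integrable_const (1 : ℝ)).congr ?_
    filter_upwards [ae_pos_invGammaMeasure ν] with t ht
    simp_rw [Real.norm_of_nonneg (gaussSemigroup_nonneg _ _), gaussSemigroup_eq_gaussianPDFReal ht]
    rw [integral_gaussianPDFReal_eq_one]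
    simpa using ht

theorem studentPDFReal_nonneg {ν : ℝ} (hν : 0 < ν) (x : ℝ) : 0 ≤ studentPDFReal ν x := by
  rw [studentPDFReal_eq_integral hν]
  exact integral_nonneg fun t => gaussSemigroup_nonneg t x

theorem measurable_studentPDFReal (ν : ℝ) : Measurable (studentPDFReal ν) := by
  unfold studentPDFReal
  fun_prop

theorem isProbabilityMeasure_studentMeasure {ν : ℝ} (hν : 0 < ν) :
    IsProbabilityMeasure (studentMeasure ν) := by
  have := isProbabilityMeasure_invGammaMeasure hν
  have hi := integrable_gaussSemigroup_prod hν
  constructor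
  rw [studentMeasure, withDensity_apply _ MeasurableSet.univ, Measure.restrict_univ,
    ← ofReal_integral_eq_lintegral_ofReal ?_
      (Filter.Eventually.of_forall (studentPDFReal_nonneg hν))]
  · simp_rw [studentPDFReal_eq_integral hν]
    rw [integral_integral_swap hi]
    have : ∀ᵐ t ∂(invGammaMeasure ν), ∫ x, gaussSemigroup t x = 1 := by
      filter_upwards [ae_pos_invGammaMeasure ν] with t ht
      simp_rw [gaussSemigroup_eq_gaussianPDFReal ht]
      rw [integral_gaussianPDFReal_eq_one]
      simpa using ht
    rw [integral_congr_ae this]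
    simp
  · simp_rw [funext (studentPDFReal_eq_integral hν)]
    exact hi.integral_prod_left

/-- By subordination, the characteristic function of a Student-t distribution is the Laplace
transform of an inverse Gamma distribution. -/
theorem charFun_studentMeasure {ν : ℝ} (hν : 0 < ν) (y : ℝ) :
    charFun (studentMeasure ν) y = (mgf id (invGammaMeasure ν) (-y ^ 2) : ℝ) := by
  have := isProbabilityMeasure_invGammaMeasure hν
  have hi := integrable_gaussSemigroup_prod hν
  have hi' : Integrable (Function.uncurry fun x t : ℝ =>
      (gaussSemigroup t x : ℂ) * Complex.exp (y * x * Complex.I))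
      (volume.prod (invGammaMeasure ν)) := by
    refine (hi.ofReal (𝕜 := ℂ)).mul_bdd (c := 1) (Measurable.aestronglyMeasurable (by fun_prop)) ?_
    refine Filter.Eventually.of_forall fun p => ?_
    rw [← Complex.ofReal_mul, Complex.norm_exp_ofReal_mul_I]
  rw [charFun_apply_real, studentMeasure, integral_withDensity_eq_integral_toReal_smul
    (measurable_studentPDFReal ν).ennreal_ofReal (by simp)]
  have h1 : ∀ x : ℝ,
      (ENNReal.ofReal (studentPDFReal ν x)).toReal • Complex.exp (y * x * Complex.I) =
      ∫ t, (gaussSemigroup t x : ℂ) * Complex.exp (y * x * Complex.I) ∂(invGammaMeasure ν) := by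
    intro x
    rw [ENNReal.toReal_ofReal (studentPDFReal_nonneg hν x), integral_mul_const,
      studentPDFReal_eq_integral hν, integral_complex_ofReal, Complex.real_smul]
  simp_rw [h1]
  rw [integral_integral_swap hi', mgf, ← integral_complex_ofReal]
  refine integral_congr_ae ?_
  filter_upwards [ae_pos_invGammaMeasure ν] with t ht
  have hv : (2 * t).toNNReal ≠ 0 := by simpa using ht
  have h2 := charFun_gaussianReal (μ := 0) (v := (2 * t).toNNReal) y
  rw [charFun_apply_real, integral_gaussianReal_eq_integral_smul hv] at h2
  simp_rw [gaussSemigroup_eq_gaussianPDFReal ht]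
  simp_rw [Complex.real_smul] at h2
  rw [h2, Real.coe_toNNReal _ (by positivity)]
  push_cast
  congr 1
  simp only [id]
  ring

/-! ### Laplace transforms of inverse Gamma distributions -/

theorem integrable_exp_mul_invGammaMeasure {ν s : ℝ} (hν : 0 < ν) (hs : s ≤ 0) :
    Integrable (fun t => Real.exp (s * t)) (invGammaMeasure ν) := by
  have := isProbabilityMeasure_invGammaMeasure hν
  refine Integrable.of_bound (C := 1) (Measurable.aestronglyMeasurable (by fun_prop)) ?_
  filter_upwards [ae_pos_invGammaMeasure ν] with t ht
  rw [Real.norm_of_nonneg (Real.exp_pos _).le, Real.exp_le_one_iff]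
  exact mul_nonpos_of_nonpos_of_nonneg hs ht.le

theorem mem_interior_integrableExpSet_invGammaMeasure {ν s : ℝ} (hν : 0 < ν) (hs : s < 0) :
    s ∈ interior (integrableExpSet id (invGammaMeasure ν)) := by
  have h : Set.Iic (0 : ℝ) ⊆ integrableExpSet id (invGammaMeasure ν) := fun u hu =>
    integrable_exp_mul_invGammaMeasure hν hu
  exact interior_mono h (by rwa [interior_Iic])

theorem continuousOn_mgf_neg_invGammaMeasure {ν : ℝ} (hν : 0 < ν) :
    ContinuousOn (fun x => mgf id (invGammaMeasure ν) (-x)) (Set.Ici 0) := by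
  have := isProbabilityMeasure_invGammaMeasure hν
  unfold mgf
  refine continuousOn_of_dominated (bound := fun _ => 1)
    (fun x _ => Measurable.aestronglyMeasurable (by fun_prop)) (fun x hx => ?_)
    (integrable_const _) (Filter.Eventually.of_forall fun t => by fun_prop)
  filter_upwards [ae_pos_invGammaMeasure ν] with t ht
  rw [Real.norm_of_nonneg (Real.exp_pos _).le, Real.exp_le_one_iff]
  exact mul_nonpos_of_nonpos_of_nonneg (neg_nonpos.mpr hx) ht.le

/-- Multiplication by `t` lowers the shape parameter by one. -/
theorem mul_invGammaPDFReal_add_one {ν t : ℝ} (hν : 0 < ν) (ht : 0 < t) :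
    t * invGammaPDFReal (ν + 1) t = invGammaPDFReal ν t / (4 * ν) := by
  have := Real.Gamma_pos_of_pos hν
  have h1 : t * t ^ (-(ν + 1) - 1) = t ^ (-ν - 1) := by
    rw [mul_comm, ← Real.rpow_add_one ht.ne']; congr 1; ring
  have h2 : (2 : ℝ) ^ (2 * (ν + 1)) = 4 * 2 ^ (2 * ν) := by
    rw [two_rpow_two_mul, two_rpow_two_mul, Real.rpow_add_one (by norm_num), mul_comm]
  rw [invGammaPDFReal, invGammaPDFReal, if_pos ht, if_pos ht, Real.Gamma_add_one hν.ne', h2, ← h1]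
  field_simp

theorem hasDerivAt_mgf_neg_invGammaMeasure {ν x : ℝ} (hν : 0 < ν) (hx : 0 < x) :
    HasDerivAt (fun x => mgf id (invGammaMeasure ν) (-x))
      (-∫ t, t * Real.exp (-x * t) ∂(invGammaMeasure ν)) x := by
  have h := hasDerivAt_mgf (mem_interior_integrableExpSet_invGammaMeasure hν (neg_neg_of_pos hx))
  exact (h.comp x (hasDerivAt_neg x)).congr_deriv (by simp)

theorem integral_mul_exp_invGammaMeasure_add_one {ν : ℝ} (hν : 0 < ν) (s : ℝ) :
    ∫ t, t * Real.exp (s * t) ∂(invGammaMeasure (ν + 1)) =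
      mgf id (invGammaMeasure ν) s / (4 * ν) := by
  rw [mgf, integral_invGammaMeasure (by positivity), integral_invGammaMeasure hν,
    ← integral_div]
  refine setIntegral_congr_fun measurableSet_Ioi fun t ht => ?_
  have := mul_invGammaPDFReal_add_one hν ht
  simp only [id]
  linear_combination Real.exp (s * t) * this

/-- The substitution `t ↦ 1 / (4 x t)` exchanges the two exponentials `exp (-x t)` and
`exp (-1 / (4 t))`. -/
theorem integral_mul_exp_invGammaMeasure_half {x : ℝ} (hx : 0 < x) :
    ∫ t, t * Real.exp (-x * t) ∂(invGammaMeasure (1 / 2)) =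
      mgf id (invGammaMeasure (1 / 2)) (-x) / (2 * Real.sqrt x) := by
  have hc : 0 < 1 / (4 * x) := by positivity
  rw [mgf, integral_invGammaMeasure (by norm_num), integral_invGammaMeasure (by norm_num)]
  set h : ℝ → ℝ := fun t => invGammaPDFReal (1 / 2) t * (t * Real.exp (-x * t)) with hh
  have h1 := integral_comp_rpow_Ioi (fun y : ℝ => h (1 / (4 * x) * y)) (p := -1) (by norm_num)
  rw [integral_comp_mul_left_Ioi h 0 hc, mul_zero, smul_eq_mul, inv_mul_eq_div,
    eq_div_iff hc.ne'] at h1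
  rw [← h1, ← integral_mul_const, ← integral_div]
  refine setIntegral_congr_fun measurableSet_Ioi fun t ht => ?_
  have ht : 0 < t := ht
  have hs := Real.sqrt_pos.mpr hx
  have hst := Real.sqrt_pos.mpr ht
  have hr : ∀ y : ℝ, 0 < y → y ^ (-(1 / 2 : ℝ) - 1) = 1 / (y * Real.sqrt y) := by
    intro y hy
    rw [Real.sqrt_eq_rpow, show -(1 / 2 : ℝ) - 1 = -(1 + 1 / 2) by ring, Real.rpow_neg hy.le,
      Real.rpow_add hy, Real.rpow_one, ← one_div]
  have ht2 : t ^ (-1 - 1 : ℝ) = 1 / t ^ 2 := by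
    rw [show (-1 - 1 : ℝ) = -(2 : ℕ) by norm_num, Real.rpow_neg ht.le, Real.rpow_natCast, one_div]
  have hpos : 0 < 1 / (4 * x) * t⁻¹ := by positivity
  have e1 : 1 / (4 * (1 / (4 * x) * t⁻¹)) = x * t := by field_simp
  have e2 : -x * (1 / (4 * x) * t⁻¹) = -(1 / (4 * t)) := by field_simp
  have e3 : Real.sqrt (1 / (4 * x) * t⁻¹) = 1 / (2 * Real.sqrt x * Real.sqrt t) := by
    rw [← one_div, div_mul_div_comm, one_mul, Real.sqrt_div zero_le_one, Real.sqrt_one,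
      Real.sqrt_mul (by positivity), Real.sqrt_mul (by norm_num), show (4 : ℝ) = 2 ^ 2 by norm_num,
      Real.sqrt_sq (by norm_num)]
  simp only [hh, abs_neg, abs_one, one_mul, smul_eq_mul, id, Real.rpow_neg_one, ht2]
  rw [invGammaPDFReal, invGammaPDFReal, if_pos ht, if_pos hpos, hr _ ht, hr _ hpos, e1, e2, e3,
    neg_mul]
  have hG := Real.Gamma_pos_of_pos (show (0 : ℝ) < 1 / 2 by norm_num)
  have hx2 : Real.sqrt x ^ 2 = x := Real.sq_sqrt hx.le
  have ht3 : Real.sqrt t ^ 2 = t := Real.sq_sqrt ht.le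
  field_simp
  rw [ht3, hx2]
  ring

theorem eq_of_hasDerivAt_eq_of_pos {f g f' : ℝ → ℝ} (hf : ContinuousOn f (Set.Ici 0))
    (hg : ContinuousOn g (Set.Ici 0)) (hf' : ∀ x, 0 < x → HasDerivAt f (f' x) x)
    (hg' : ∀ x, 0 < x → HasDerivAt g (f' x) x) (h0 : f 0 = g 0) {x : ℝ} (hx : 0 ≤ x) :
    f x = g x := by
  rcases hx.eq_or_lt with rfl | hx
  · exact h0
  have hc : ContinuousOn (f - g) (Set.Icc 0 x) := (hf.sub hg).mono Set.Icc_subset_Ici_self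
  obtain ⟨c, _, h⟩ := exists_hasDerivAt_eq_slope (f - g) (fun _ => 0) hx hc fun y hy => by
    simpa using (hf' y hy.1).sub (hg' y hy.1)
  rw [eq_comm, div_eq_zero_iff] at h
  rcases h with h | h
  · simp only [Pi.sub_apply] at h; linarith
  · linarith

/-- The function `exp (-u) qₙ(u)` with `u = √x`. For `0 ≤ x` it is the Laplace transform of the
inverse Gamma distribution with shape `n + 1/2`. -/
noncomputable def besselLaplace (n : ℕ) (x : ℝ) : ℝ :=
  Real.exp (-Real.sqrt x) * (besselQ n).eval (Real.sqrt x)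

theorem continuous_besselLaplace (n : ℕ) : Continuous (besselLaplace n) := by
  unfold besselLaplace
  fun_prop

theorem besselLaplace_zero_right (n : ℕ) : besselLaplace n 0 = 1 := by
  simp [besselLaplace]

theorem hasDerivAt_besselLaplace_succ (n : ℕ) {x : ℝ} (hx : 0 < x) :
    HasDerivAt (besselLaplace (n + 1)) (-(besselLaplace n x / (4 * (n + 1 / 2)))) x := by
  have hs := Real.hasDerivAt_sqrt hx.ne'
  have h := hs.neg.exp.mul (((besselQ (n + 1)).hasDerivAt (Real.sqrt x)).comp x hs)
  refine h.congr_deriv ?_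
  have hpos := Real.sqrt_pos.mpr hx
  rw [derivative_besselQ_succ, besselLaplace]
  simp only [Polynomial.eval_sub, Polynomial.eval_mul, Polynomial.eval_C, Polynomial.eval_X,
    Function.comp_apply, Pi.neg_apply]
  have : (2 * (n : ℝ) + 1) ≠ 0 := by positivity
  have : (4 * ((n : ℝ) + 1 / 2)) ≠ 0 := by positivity
  field_simp
  ring

/-- Both sides are continuous on `[0, ∞)` with value `1` at `0`, and both derivatives lower the
index `n` in the same way; the case `n = 0` is a first order equation of its own. -/
theorem mgf_invGammaMeasure_half (n : ℕ) {x : ℝ} (hx : 0 ≤ x) :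
    mgf id (invGammaMeasure (n + 1 / 2)) (-x) = besselLaplace n x := by
  have hν : ∀ n : ℕ, (0 : ℝ) < n + 1 / 2 := fun n => by positivity
  have hp := fun n : ℕ => isProbabilityMeasure_invGammaMeasure (hν n)
  have h0 : ∀ n : ℕ, mgf id (invGammaMeasure (n + 1 / 2)) (-0) = 1 := fun n => by
    have := hp n
    rw [neg_zero, mgf_zero]
  induction n generalizing x with
  | zero =>
    -- both sides solve `f' = -f / (2 √x)`, so multiplying by `exp √x` gives constants
    have key : mgf id (invGammaMeasure ((0 : ℕ) + 1 / 2)) (-x) * Real.exp (Real.sqrt x) = 1 := by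
      refine eq_of_hasDerivAt_eq_of_pos (g := fun _ => 1) (f' := fun _ => 0)
        (f := fun x => mgf id (invGammaMeasure ((0 : ℕ) + 1 / 2)) (-x) * Real.exp (Real.sqrt x))
        ((continuousOn_mgf_neg_invGammaMeasure (hν 0)).mul (by fun_prop)) continuousOn_const
        (fun y hy => ?_) (fun y _ => hasDerivAt_const y _) ?_ hx
      · have hs := (Real.hasDerivAt_sqrt hy.ne').exp
        refine ((hasDerivAt_mgf_neg_invGammaMeasure (hν 0) hy).mul hs).congr_deriv ?_
        rw [Nat.cast_zero, zero_add, integral_mul_exp_invGammaMeasure_half hy]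
        ring
      · simp only [h0 0, Real.sqrt_zero, Real.exp_zero, mul_one]
    rw [besselLaplace, besselQ_zero, Polynomial.eval_one, mul_one, Real.exp_neg,
      ← one_div, eq_div_iff (Real.exp_pos _).ne', key]
  | succ n ih =>
    refine eq_of_hasDerivAt_eq_of_pos
      (f := fun x => mgf id (invGammaMeasure ((n + 1 : ℕ) + 1 / 2)) (-x))
      (f' := fun x => -(besselLaplace n x / (4 * (n + 1 / 2))))
      (continuousOn_mgf_neg_invGammaMeasure (hν (n + 1)))
      (continuous_besselLaplace (n + 1)).continuousOn
      (fun y hy => ?_) (fun y hy => hasDerivAt_besselLaplace_succ n hy) ?_ hx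
    · refine (hasDerivAt_mgf_neg_invGammaMeasure (hν (n + 1)) hy).congr_deriv ?_
      rw [show ((n + 1 : ℕ) : ℝ) + 1 / 2 = (n + 1 / 2) + 1 by push_cast; ring,
        integral_mul_exp_invGammaMeasure_add_one (hν n), ih hy.le]
    · simp only [h0 (n + 1), besselLaplace_zero_right]

theorem charFun_studentMeasure_half (n : ℕ) (y : ℝ) :
    charFun (studentMeasure (n + 1 / 2)) y =
      (Real.exp (-|y|) * (besselQ n).eval |y| : ℝ) := by
  rw [charFun_studentMeasure (by positivity), mgf_invGammaMeasure_half n (sq_nonneg y),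
    besselLaplace, Real.sqrt_sq_eq_abs]

/-- Finite measures on the line whose Laplace transforms exist and agree on the half-line are
equal: after multiplication by `exp (-t)`, the moment generating functions are holomorphic on a
half-plane that contains the imaginary axis, where they are the characteristic functions. -/
theorem ext_of_mgf_eq_of_nonpos {μ ν : Measure ℝ}
    (hμ : ∀ s ≤ 0, Integrable (fun t => Real.exp (s * t)) μ)
    (hν : ∀ s ≤ 0, Integrable (fun t => Real.exp (s * t)) ν)
    (h : ∀ s ≤ 0, mgf id μ s = mgf id ν s) : μ = ν := by
  let w : ℝ → ENNReal := fun t => ENNReal.ofReal (Real.exp (-t))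
  have hw : Measurable w := by fun_prop
  have hint : ∀ ρ : Measure ℝ, (∀ s ≤ 0, Integrable (fun t => Real.exp (s * t)) ρ) → ∀ s ≤ 1,
      Integrable (fun t => Real.exp (s * t)) (ρ.withDensity w) := by
    intro ρ hρ s hs
    rw [integrable_withDensity_iff_integrable_smul' hw (by simp [w])]
    refine (hρ (s - 1) (by linarith)).congr (Filter.Eventually.of_forall fun t => ?_)
    simp only [w]
    rw [ENNReal.toReal_ofReal (Real.exp_pos _).le, smul_eq_mul, ← Real.exp_add]
    ring_nf
  have hmgf : ∀ (ρ : Measure ℝ) (s : ℝ), mgf id (ρ.withDensity w) s = mgf id ρ (s - 1) := by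
    intro ρ s
    rw [mgf, mgf, integral_withDensity_eq_integral_toReal_smul hw (by simp [w])]
    congr 1
    ext t
    simp only [w, id]
    rw [ENNReal.toReal_ofReal (Real.exp_pos _).le, smul_eq_mul, ← Real.exp_add]
    ring_nf
  have hfin : ∀ ρ : Measure ℝ, (∀ s ≤ 0, Integrable (fun t => Real.exp (s * t)) ρ) →
      IsFiniteMeasure (ρ.withDensity w) := by
    intro ρ hρ
    have := hint ρ hρ 0 zero_le_one
    simp only [zero_mul, Real.exp_zero] at this
    exact (integrable_const_iff_isFiniteMeasure one_ne_zero).mp this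
  have := hfin μ hμ
  have := hfin ν hν
  let U : Set ℂ := {z | z.re < 1}
  have hU : ∀ ρ : Measure ℝ, (∀ s ≤ 0, Integrable (fun t => Real.exp (s * t)) ρ) →
      AnalyticOnNhd ℂ (complexMGF id (ρ.withDensity w)) U := by
    intro ρ hρ
    refine analyticOnNhd_complexMGF.mono fun z hz => ?_
    have hsub : Set.Iic (1 : ℝ) ⊆ integrableExpSet id (ρ.withDensity w) := fun s hs =>
      hint ρ hρ s hs
    exact interior_mono hsub (by rw [interior_Iic]; exact hz)
  have hUc : IsPreconnected U := (convex_halfSpace_re_lt 1).isPreconnected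
  have hfreq : ∃ᶠ z in nhdsWithin (0 : ℂ) {0}ᶜ,
      complexMGF id (μ.withDensity w) z = complexMGF id (ν.withDensity w) z := by
    have ht : Filter.Tendsto (fun x : ℝ => (x : ℂ)) (nhdsWithin 0 (Set.Iio 0))
        (nhdsWithin (0 : ℂ) {0}ᶜ) := by
      refine tendsto_nhdsWithin_iff.mpr ⟨?_, ?_⟩
      · exact (Complex.continuous_ofReal.tendsto' 0 0 rfl).mono_left nhdsWithin_le_nhds
      · filter_upwards [self_mem_nhdsWithin] with x hx
        simpa using (show x < 0 from hx).ne
    refine ht.frequently (Filter.Eventually.frequently ?_)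
    filter_upwards [self_mem_nhdsWithin] with x hx
    have hx : x < 0 := hx
    rw [complexMGF_ofReal, complexMGF_ofReal, hmgf, hmgf, h (x - 1) (by linarith)]
  have heq := (hU μ hμ).eqOn_of_preconnected_of_frequently_eq (hU ν hν) hUc
    (show (0 : ℂ) ∈ U by simp [U]) hfreq
  have hwd : μ.withDensity w = ν.withDensity w := by
    apply Measure.ext_of_charFun
    ext t
    rw [← complexMGF_id_mul_I, ← complexMGF_id_mul_I]
    exact heq (by simp [U])
  have hw0 : ∀ t, w t ≠ 0 := fun t => by simp [w, Real.exp_pos]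
  have hwt : ∀ t, w t ≠ ⊤ := fun t => by simp [w]
  rw [← withDensity_inv_same (μ := μ) hw (.of_forall hw0) (.of_forall hwt), hwd,
    withDensity_inv_same (μ := ν) hw (.of_forall hw0) (.of_forall hwt)]

/-! ### Mixtures and convolutions -/

/-- The measure `∑ k ∈ s, c k • μ k`, where negative weights are read as `0`. -/
noncomputable def mixture (s : Finset ℕ) (c : ℕ → ℝ) (μ : ℕ → Measure ℝ) : Measure ℝ :=
  ∑ k ∈ s, ENNReal.ofReal (c k) • μ k

section Mixture

variable {s : Finset ℕ} {c : ℕ → ℝ} {μ : ℕ → Measure ℝ}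

instance isFiniteMeasure_mixture [∀ k, IsFiniteMeasure (μ k)] :
    IsFiniteMeasure (mixture s c μ) := by
  constructor
  rw [mixture, Measure.finsetSum_apply]
  exact ENNReal.sum_lt_top.mpr fun k _ => ENNReal.mul_lt_top ENNReal.ofReal_lt_top
    (measure_lt_top _ _)

theorem real_mixture [∀ k, IsFiniteMeasure (μ k)] (B : Set ℝ) :
    (mixture s c μ).real B = ∑ k ∈ s, max (c k) 0 * (μ k).real B := by
  rw [Measure.real, mixture, Measure.finsetSum_apply, ENNReal.toReal_sum]
  · refine Finset.sum_congr rfl fun k _ => ?_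
    rw [Measure.smul_apply, smul_eq_mul, ENNReal.toReal_mul, ENNReal.toReal_ofReal']
    rfl
  · exact fun k _ => ENNReal.mul_ne_top ENNReal.ofReal_ne_top (measure_ne_top _ _)

theorem integrable_mixture {E : Type*} [NormedAddCommGroup E] {f : ℝ → E}
    (hf : ∀ k ∈ s, Integrable f (μ k)) : Integrable f (mixture s c μ) :=
  integrable_finsetSum_measure.mpr fun k hk => (hf k hk).smul_measure ENNReal.ofReal_ne_top

theorem integral_mixture {E : Type*} [NormedAddCommGroup E] [NormedSpace ℝ E] {f : ℝ → E}
    (hf : ∀ k ∈ s, Integrable f (μ k)) :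
    ∫ t, f t ∂(mixture s c μ) = ∑ k ∈ s, max (c k) 0 • ∫ t, f t ∂(μ k) := by
  rw [mixture, integral_finsetSum_measure fun k hk =>
    (hf k hk).smul_measure ENNReal.ofReal_ne_top]
  refine Finset.sum_congr rfl fun k _ => ?_
  rw [integral_smul_measure, ENNReal.toReal_ofReal']

/-- A linear relation between measures, tested on sets, gives one between integrals: separate the
positive from the negative weights. -/
theorem sum_smul_integral_eq_zero [∀ k, IsFiniteMeasure (μ k)] {E : Type*} [NormedAddCommGroup E]
    [NormedSpace ℝ E] {f : ℝ → E} (hf : ∀ k ∈ s, Integrable f (μ k))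
    (h : ∀ B, MeasurableSet B → ∑ k ∈ s, c k * (μ k).real B = 0) :
    ∑ k ∈ s, c k • ∫ t, f t ∂(μ k) = 0 := by
  have hmax : ∀ x : ℝ, x = max x 0 - max (-x) 0 := fun x =>
    (max_zero_sub_max_neg_zero_eq_self x).symm
  have heq : mixture s c μ = mixture s (fun k => -c k) μ := by
    ext B hB
    rw [← measureReal_eq_measureReal_iff, real_mixture, real_mixture, ← sub_eq_zero,
      ← Finset.sum_sub_distrib]
    refine Eq.trans ?_ (h B hB)
    refine Finset.sum_congr rfl fun k _ => ?_
    rw [← sub_mul, ← hmax]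
  have hi := congrArg (fun ρ => ∫ t, f t ∂ρ) heq
  simp only [integral_mixture hf] at hi
  rw [← sub_eq_zero, ← Finset.sum_sub_distrib] at hi
  rw [← hi]
  refine Finset.sum_congr rfl fun k _ => ?_
  rw [← sub_smul, ← hmax]

end Mixture

theorem mixture_withDensity_ofReal {s : Finset ℕ} {c : ℕ → ℝ} {f : ℕ → ℝ → ℝ} (hc : ∀ k, 0 ≤ c k)
    (hf : ∀ k, Measurable (f k)) (hf0 : ∀ k t, 0 ≤ f k t) :
    mixture s c (fun k => volume.withDensity fun t => ENNReal.ofReal (f k t)) =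
      volume.withDensity fun t => ENNReal.ofReal (∑ k ∈ s, c k * f k t) := by
  ext B hB
  rw [mixture, Measure.finsetSum_apply, withDensity_apply _ hB]
  simp_rw [ENNReal.ofReal_sum_of_nonneg fun k _ => mul_nonneg (hc k) (hf0 k _),
    ENNReal.ofReal_mul (hc _)]
  rw [lintegral_finsetSum _ fun k _ => ((hf k).ennreal_ofReal.const_mul _)]
  refine Finset.sum_congr rfl fun k _ => ?_
  rw [Measure.smul_apply, withDensity_apply _ hB, lintegral_const_mul _ (hf k).ennreal_ofReal,
    smul_eq_mul]

theorem forall_eq_zero_of_sum_besselQ_eval {s : Finset ℕ} {d : ℕ → ℝ}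
    (h : ∀ u : ℝ, 0 ≤ u → ∑ k ∈ s, d k * (besselQ k).eval u = 0) : ∀ k ∈ s, d k = 0 := by
  refine eqOn_zero_of_sum_besselQ_eq_zero ?_
  refine Polynomial.eq_zero_of_infinite_isRoot _ ((Set.Ici_infinite (0 : ℝ)).mono fun u hu => ?_)
  change Polynomial.eval u _ = 0
  rw [Polynomial.eval_finsetSum, ← h u hu]
  simp

theorem mgf_conv_id {μ ν : Measure ℝ} [SFinite μ] [SFinite ν] (s : ℝ) :
    mgf id (μ.conv ν) s = mgf id μ s * mgf id ν s := by
  rw [Measure.conv, mgf, integral_map (by fun_prop)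
    (Measurable.aestronglyMeasurable (by fun_prop)), mgf, mgf, ← integral_prod_mul]
  simp only [id, mul_add, Real.exp_add]

theorem integrable_exp_mul_conv {μ ν : Measure ℝ} [SFinite μ] [SFinite ν] {s : ℝ}
    (hμ : Integrable (fun t => Real.exp (s * t)) μ)
    (hν : Integrable (fun t => Real.exp (s * t)) ν) :
    Integrable (fun t => Real.exp (s * t)) (μ.conv ν) := by
  rw [Measure.conv, integrable_map_measure (Measurable.aestronglyMeasurable (by fun_prop))
    (by fun_prop)]
  refine (hμ.mul_prod hν).congr (Filter.Eventually.of_forall fun p => ?_)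
  simp only [Function.comp_apply, mul_add, Real.exp_add]

theorem mgf_map_mul_id (μ : Measure ℝ) (r s : ℝ) :
    mgf id (μ.map fun t => r * t) s = mgf id μ (s * r) := by
  rw [mgf, integral_map (by fun_prop) (Measurable.aestronglyMeasurable (by fun_prop)), mgf]
  simp only [id, mul_assoc]

theorem integrable_exp_mul_map_mul {μ : Measure ℝ} {r s : ℝ}
    (h : Integrable (fun t => Real.exp (s * r * t)) μ) :
    Integrable (fun t => Real.exp (s * t)) (μ.map fun t => r * t) := by
  rw [integrable_map_measure (Measurable.aestronglyMeasurable (by fun_prop)) (by fun_prop)]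
  simpa only [Function.comp_def, ← mul_assoc] using h

instance isProbabilityMeasure_invGammaMeasure_half (k : ℕ) :
    IsProbabilityMeasure (invGammaMeasure (k + 1 / 2)) :=
  isProbabilityMeasure_invGammaMeasure (by positivity)

instance isProbabilityMeasure_studentMeasure_half (k : ℕ) :
    IsProbabilityMeasure (studentMeasure (k + 1 / 2)) :=
  isProbabilityMeasure_studentMeasure (by positivity)

theorem besselQ_eval_mul_eval (n m : ℕ) {a : ℝ} (ha0 : 0 ≤ a) (ha1 : a ≤ 1) (u : ℝ) :
    (besselQ n).eval (a * u) * (besselQ m).eval ((1 - a) * u) =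
    ∑ k ∈ Finset.Icc (min n m) (n + m), besselBeta n m a k * (besselQ k).eval u := by
  rw [← besselProd_eval, (besselBeta_spec n m ha0 ha1).2, Polynomial.eval_finsetSum]
  simp

/-- The Laplace transforms agree: at `u ^ 2` the left one is `exp (-a u) qₙ(a u)` times
`exp (-(1 - a) u) qₘ((1 - a) u)`, which is expanded in the functions `exp (-u) qₖ(u)`. -/
theorem invGammaMeasure_conv_eq_mixture (n m : ℕ) {a : ℝ} (ha0 : 0 ≤ a) (ha1 : a ≤ 1) :
    ((invGammaMeasure (n + 1 / 2)).map (fun t => a ^ 2 * t)).conv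
      ((invGammaMeasure (m + 1 / 2)).map (fun t => (1 - a) ^ 2 * t)) =
    mixture (Finset.Icc (min n m) (n + m)) (besselBeta n m a)
      fun k => invGammaMeasure (k + 1 / 2) := by
  have hint : ∀ (k : ℕ) (s : ℝ), s ≤ 0 →
      Integrable (fun t => Real.exp (s * t)) (invGammaMeasure (k + 1 / 2)) := fun k s hs =>
    integrable_exp_mul_invGammaMeasure (by positivity) hs
  have hintm : ∀ (k : ℕ) (r s : ℝ), s ≤ 0 → Integrable (fun t => Real.exp (s * t))
      ((invGammaMeasure (k + 1 / 2)).map fun t => r ^ 2 * t) := fun k r s hs =>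
    integrable_exp_mul_map_mul (hint k _ (mul_nonpos_of_nonpos_of_nonneg hs (sq_nonneg r)))
  refine ext_of_mgf_eq_of_nonpos
    (fun s hs => integrable_exp_mul_conv (hintm n a s hs) (hintm m (1 - a) s hs))
    (fun s hs => integrable_mixture fun k _ => hint k s hs) fun s hs => ?_
  obtain ⟨x, hx, rfl⟩ : ∃ x, 0 ≤ x ∧ s = -x := ⟨-s, by linarith, by ring⟩
  have hmgf : ∀ (k : ℕ) (r : ℝ), 0 ≤ r →
      mgf id ((invGammaMeasure (k + 1 / 2)).map fun t => r ^ 2 * t) (-x) =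
        Real.exp (-(r * Real.sqrt x)) * (besselQ k).eval (r * Real.sqrt x) := by
    intro k r hr
    rw [mgf_map_mul_id, neg_mul, mgf_invGammaMeasure_half k (mul_nonneg hx (sq_nonneg r)),
      besselLaplace, mul_comm x, Real.sqrt_mul (sq_nonneg r), Real.sqrt_sq hr]
  rw [mgf_conv_id, hmgf n a ha0, hmgf m (1 - a) (by linarith), mul_mul_mul_comm, ← Real.exp_add,
    besselQ_eval_mul_eval n m ha0 ha1, mgf]
  simp only [id]
  rw [integral_mixture fun k _ => hint k _ hs,
    show -(a * Real.sqrt x) + -((1 - a) * Real.sqrt x) = -Real.sqrt x by ring, Finset.mul_sum]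
  refine Finset.sum_congr rfl fun k _ => ?_
  have := mgf_invGammaMeasure_half k hx
  rw [mgf] at this
  rw [max_eq_left ((besselBeta_spec n m ha0 ha1).1 k), smul_eq_mul]
  simp only [id] at this ⊢
  rw [this, besselLaplace]
  ring

theorem studentMeasure_conv_eq_mixture (n m : ℕ) {a : ℝ} (ha0 : 0 ≤ a) (ha1 : a ≤ 1) :
    ((studentMeasure (n + 1 / 2)).map (fun x => a * x)).conv
      ((studentMeasure (m + 1 / 2)).map (fun x => (1 - a) * x)) =
    mixture (Finset.Icc (min n m) (n + m)) (besselBeta n m a)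
      fun k => studentMeasure (k + 1 / 2) := by
  have := Measure.isProbabilityMeasure_map (μ := studentMeasure (n + 1 / 2))
    (f := fun x => a * x) (by fun_prop)
  have := Measure.isProbabilityMeasure_map (μ := studentMeasure (m + 1 / 2))
    (f := fun x => (1 - a) * x) (by fun_prop)
  apply Measure.ext_of_charFun
  ext y
  rw [charFun_conv, charFun_map_mul, charFun_map_mul, charFun_studentMeasure_half,
    charFun_studentMeasure_half, abs_mul, abs_mul, abs_of_nonneg ha0,
    abs_of_nonneg (show 0 ≤ 1 - a by linarith), ← Complex.ofReal_mul, mul_mul_mul_comm,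
    ← Real.exp_add, besselQ_eval_mul_eval n m ha0 ha1, charFun_apply_real, integral_mixture,
    show -(a * |y|) + -((1 - a) * |y|) = -|y| by ring, Finset.mul_sum, Complex.ofReal_sum]
  · refine Finset.sum_congr rfl fun k _ => ?_
    rw [max_eq_left ((besselBeta_spec n m ha0 ha1).1 k), ← charFun_apply_real,
      charFun_studentMeasure_half, Complex.real_smul, ← Complex.ofReal_mul]
    congr 1
    ring
  · intro k _
    refine Integrable.of_bound (C := 1) (Measurable.aestronglyMeasurable (by fun_prop))
      (Filter.Eventually.of_forall fun x => ?_)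
    rw [← Complex.ofReal_mul, Complex.norm_exp_ofReal_mul_I]

theorem eq_of_sum_invGammaMeasure_eq {s : Finset ℕ} {c d : ℕ → ℝ}
    (h : ∀ B, MeasurableSet B → ∑ k ∈ s, c k * (invGammaMeasure (k + 1 / 2)).real B =
      ∑ k ∈ s, d k * (invGammaMeasure (k + 1 / 2)).real B) : ∀ k ∈ s, c k = d k := by
  have h0 : ∀ B, MeasurableSet B →
      ∑ k ∈ s, (c k - d k) * (invGammaMeasure (k + 1 / 2)).real B = 0 := fun B hB => by
    simp only [sub_mul, Finset.sum_sub_distrib, h B hB, sub_self]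
  suffices ∀ k ∈ s, c k - d k = 0 from fun k hk => sub_eq_zero.mp (this k hk)
  refine forall_eq_zero_of_sum_besselQ_eval fun u hu => ?_
  have hi := sum_smul_integral_eq_zero (f := fun t => Real.exp (-u ^ 2 * t))
    (fun k _ => integrable_exp_mul_invGammaMeasure (by positivity) (by simp [sq_nonneg])) h0
  apply mul_left_cancel₀ (Real.exp_pos (-u)).ne'
  rw [mul_zero, ← hi, Finset.mul_sum]
  refine Finset.sum_congr rfl fun k _ => ?_
  have := mgf_invGammaMeasure_half k (sq_nonneg u)
  rw [mgf] at this
  simp only [id] at this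
  rw [this, besselLaplace, Real.sqrt_sq hu, smul_eq_mul]
  ring

theorem eq_of_sum_studentMeasure_eq {s : Finset ℕ} {c d : ℕ → ℝ}
    (h : ∀ B, MeasurableSet B → ∑ k ∈ s, c k * (studentMeasure (k + 1 / 2)).real B =
      ∑ k ∈ s, d k * (studentMeasure (k + 1 / 2)).real B) : ∀ k ∈ s, c k = d k := by
  have h0 : ∀ B, MeasurableSet B →
      ∑ k ∈ s, (c k - d k) * (studentMeasure (k + 1 / 2)).real B = 0 := fun B hB => by
    simp only [sub_mul, Finset.sum_sub_distrib, h B hB, sub_self]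
  suffices ∀ k ∈ s, c k - d k = 0 from fun k hk => sub_eq_zero.mp (this k hk)
  refine forall_eq_zero_of_sum_besselQ_eval fun u hu => ?_
  have hi := sum_smul_integral_eq_zero (f := fun x : ℝ => Complex.exp (u * x * Complex.I))
    (fun k _ => Integrable.of_bound (C := 1) (Measurable.aestronglyMeasurable (by fun_prop))
      (Filter.Eventually.of_forall fun x => by
        rw [← Complex.ofReal_mul, Complex.norm_exp_ofReal_mul_I])) h0
  simp only [← charFun_apply_real] at hi
  simp only [charFun_studentMeasure_half, abs_of_nonneg hu, Complex.real_smul,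
    ← Complex.ofReal_mul, ← Complex.ofReal_sum, Complex.ofReal_eq_zero] at hi
  apply mul_left_cancel₀ (Real.exp_pos (-u)).ne'
  rw [mul_zero, ← hi, Finset.mul_sum]
  refine Finset.sum_congr rfl fun k _ => ?_
  ring

/-! ### The equivalent expansion problems -/

theorem mainTheorem7 (n m : ℕ) (a : ℝ) (ha0 : 0 ≤ a) (ha1 : a ≤ 1) :
    -- the linearization coefficients
    (∀ u : ℝ, (besselQ n).eval (a * u) * (besselQ m).eval ((1 - a) * u) =
      ∑ k ∈ Finset.Icc (min n m) (n + m), besselBeta n m a k * (besselQ k).eval u) ∧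
    -- they are the weights of a convex combination
    (∀ k, 0 ≤ besselBeta n m a k) ∧
    (∑ k ∈ Finset.Icc (min n m) (n + m), besselBeta n m a k = 1) ∧
    -- the density of `a² Z_n + (1 - a)² Z_m`
    (∀ {Ω : Type*} [MeasurableSpace Ω] (P : Measure Ω) [IsProbabilityMeasure P] (Z W : Ω → ℝ),
      HasLaw Z (invGammaMeasure (n + 1 / 2)) P →
      HasLaw W (invGammaMeasure (m + 1 / 2)) P →
      IndepFun Z W P →
      HasLaw (fun ω => a ^ 2 * Z ω + (1 - a) ^ 2 * W ω)
        (volume.withDensity fun t => ENNReal.ofReal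
          (∑ k ∈ Finset.Icc (min n m) (n + m),
            besselBeta n m a k * invGammaPDFReal (k + 1 / 2) t)) P) ∧
    -- the inverse Gamma and Student-t distributions are genuine probability distributions, and
    -- the latter are subordinated to the Gaussian semigroup by the former
    (∀ ν : ℝ, 0 < ν →
      IsProbabilityMeasure (invGammaMeasure ν) ∧ IsProbabilityMeasure (studentMeasure ν) ∧
      ∀ x : ℝ, studentPDFReal ν x = ∫ t, gaussSemigroup t x ∂(invGammaMeasure ν)) ∧
    -- the same coefficients solve the three expansion problems, and they are unique
    (∀ c : ℕ → ℝ, List.TFAE [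
      ∀ k ∈ Finset.Icc (min n m) (n + m), c k = besselBeta n m a k,
      ∀ u : ℝ, (besselQ n).eval (a * u) * (besselQ m).eval ((1 - a) * u) =
        ∑ k ∈ Finset.Icc (min n m) (n + m), c k * (besselQ k).eval u,
      ∀ B : Set ℝ, MeasurableSet B →
        (((studentMeasure (n + 1 / 2)).map (fun x => a * x)).conv
          ((studentMeasure (m + 1 / 2)).map (fun x => (1 - a) * x))).real B =
        ∑ k ∈ Finset.Icc (min n m) (n + m), c k * (studentMeasure (k + 1 / 2)).real B,
      ∀ B : Set ℝ, MeasurableSet B →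
        (((invGammaMeasure (n + 1 / 2)).map (fun t => a ^ 2 * t)).conv
          ((invGammaMeasure (m + 1 / 2)).map (fun t => (1 - a) ^ 2 * t))).real B =
        ∑ k ∈ Finset.Icc (min n m) (n + m), c k * (invGammaMeasure (k + 1 / 2)).real B]) := by
  have hβ0 := (besselBeta_spec n m ha0 ha1).1
  have hlin := besselQ_eval_mul_eval n m ha0 ha1
  have hreal : ∀ (μ : ℕ → Measure ℝ) [∀ k, IsFiniteMeasure (μ k)] (B : Set ℝ),
      (mixture (Finset.Icc (min n m) (n + m)) (besselBeta n m a) μ).real B =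
        ∑ k ∈ Finset.Icc (min n m) (n + m), besselBeta n m a k * (μ k).real B := fun μ _ B => by
    rw [real_mixture]
    exact Finset.sum_congr rfl fun k _ => by rw [max_eq_left (hβ0 k)]
  refine ⟨hlin, hβ0, ?_, ?_, fun ν hν => ⟨isProbabilityMeasure_invGammaMeasure hν,
    isProbabilityMeasure_studentMeasure hν, studentPDFReal_eq_integral hν⟩, fun c => ?_⟩
  · simpa using (hlin 0).symm
  · intro Ω _ P _ Z W hZ hW hZW
    have hindep : IndepFun (fun ω => a ^ 2 * Z ω) (fun ω => (1 - a) ^ 2 * W ω) P :=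
      hZW.comp (φ := fun t => a ^ 2 * t) (ψ := fun t => (1 - a) ^ 2 * t) (by fun_prop) (by fun_prop)
    have hZm := hZ.aemeasurable
    have hWm := hW.aemeasurable
    refine ⟨by fun_prop, ?_⟩
    have hadd := hindep.map_add_eq_map_conv_map₀ (by fun_prop) (by fun_prop)
    have hZ' : P.map (fun ω => a ^ 2 * Z ω) =
        (invGammaMeasure (n + 1 / 2)).map fun t => a ^ 2 * t := by
      rw [← hZ.map_eq, AEMeasurable.map_map_of_aemeasurable (by fun_prop) hZm]
      rfl
    have hW' : P.map (fun ω => (1 - a) ^ 2 * W ω) =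
        (invGammaMeasure (m + 1 / 2)).map fun t => (1 - a) ^ 2 * t := by
      rw [← hW.map_eq, AEMeasurable.map_map_of_aemeasurable (by fun_prop) hWm]
      rfl
    rw [hZ', hW', invGammaMeasure_conv_eq_mixture n m ha0 ha1] at hadd
    rw [← mixture_withDensity_ofReal hβ0 (fun k => measurable_invGammaPDFReal _)
      (fun k => invGammaPDFReal_nonneg (by positivity))]
    exact hadd
  · rw [invGammaMeasure_conv_eq_mixture n m ha0 ha1, studentMeasure_conv_eq_mixture n m ha0 ha1]
    simp only [hreal]
    tfae_have 1 → 2 := fun h u => by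
      rw [hlin]
      exact Finset.sum_congr rfl fun k hk => by rw [h k hk]
    tfae_have 2 → 1 := fun h => by
      suffices ∀ k ∈ Finset.Icc (min n m) (n + m), c k - besselBeta n m a k = 0 from
        fun k hk => sub_eq_zero.mp (this k hk)
      refine forall_eq_zero_of_sum_besselQ_eval fun u _ => ?_
      simp only [sub_mul, Finset.sum_sub_distrib]
      rw [← h u, hlin u, sub_self]
    tfae_have 1 → 3 := fun h B _ => Finset.sum_congr rfl fun k hk => by rw [h k hk]
    tfae_have 3 → 1 := fun h => eq_of_sum_studentMeasure_eq fun B hB => (h B hB).symm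
    tfae_have 1 → 4 := fun h B _ => Finset.sum_congr rfl fun k hk => by rw [h k hk]
    tfae_have 4 → 1 := fun h => eq_of_sum_invGammaMeasure_eq fun B hB => (h B hB).symm
    tfae_finish
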